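/- Let $\rho = 1+\sqrt2$. Let $\pi^{(0)}$ be the empty vector, $\pi^{(1)} = [\sqrt2]$ and $\pi^{(m+1)} = [\pi^{(m)}, 1+\rho^{m-1}, \pi^{(m)}]$ for $m\ge 1$, so that $\pi^{(m)}\in\mathbb{R}^{2^m-1}$. Let $\gamma_m = \frac12\big(1+\sqrt{1+4\rho^m}\big)$ for $m \ge 0$, let $\underline{\pi}^{(m)} = [\gamma_m, \pi^{(m)}] \in \mathbb{R}^{2^m}$ be the left silver schedule, and let $T_m = 1+\gamma_m+\sum_{i=0}^{2^m-2}\pi^{(m)}_i$ (so $T_0 = 1+\gamma_0$). For $\lambda>0$ and a proper, closed, convex function $f:\mathbb{R}^d\to\mathbb{R}\cup\{\infty\}$ with a minimizer, let $\mathrm{Prox}_{\lambda f}(x) = \arg\min_{u}\{f(u)+\frac1{2\lambda}\|x-u\|^2\}$ and let $f^\lambda(x) = \min_{u}\{f(u)+\frac1{2\lambda}\|x-u\|^2\}$ be the Moreau envelope of $f$. The relaxed proximal point algorithm (RPPA) with schedule $\boldsymbol\alpha=(\alpha_0,\dots,\alpha_{N-1})$ and starting point $x^0$ generates $z^k = \mathrm{Prox}_{\lambda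 f}(x^k)$ for $0\le k\le N$ and $x^{k+1} = x^k+\alpha_k(z^k-x^k)$ for $0\le k<N$. **Theorem.** Let $m\ge 0$ and $N=2^m$. 1. Let $d \ge 0$ and let $f$, $\lambda$ be as above. Let $x^0\in\mathrm{dom}(f) = \{x : f(x)<\infty\}$ and let $x^\star$ be any minimizer of $f$. Then $f^\lambda$ is finite everywhere, $\mathrm{Prox}_{\lambda f}$ is well defined and single-valued on $\mathbb{R}^d$, and for the sequence generated by RPPA with schedule $\boldsymbol\alpha=\underline{\pi}^{(m)}$ started at $x^0$, $f^\lambda$ is differentiable at $x^N$ and $$\frac{\lambda}{2}\big\|\nabla f^\lambda(x^N)\big\|^2 \le \frac{1}{2T_m}\big(f(x^0)-f(x^\star)\big).$$ 2. The bound satisfies $\frac{1}{2T_m}\Delta \sim \frac{1}{2N^{\log_2\rho}}\Delta$ for every fixed $\Delta>0$, and $T_m\sim N^{\log_2\rho}$, where $N=2^m$ and $a_m\sim b_m$ means $\lim_{m\to\infty}a_m/b_m = 1$. 3. The bound is tight: for all $m\ge0$, $d\ge1$ and $\lambda>0$ there are a proper, closed, convex function $f:\mathbb{R}^d\to\mathbb{R}\cup\{\infty\}$,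 a minimizer $x^\star$ of $f$ and a point $x^0\in\mathrm{dom}(f)$ with $f(x^0)>f(x^\star)$ such that equality holds in the inequality of part 1. -/

import Mathlib

open Filter Topology

noncomputable section

namespace RPPA

/-- `ℝ^d` with the Euclidean norm. -/
abbrev Space (d : ℕ) : Type := EuclideanSpace ℝ (Fin d)

/-- `f : ℝ^d → ℝ ∪ {∞}` is proper, closed (lower semicontinuous) and convex. -/
structure ProperClosedConvex {d : ℕ} (f : Space d → EReal) : Prop where
  ne_bot : ∀ x, f x ≠ ⊥
  exists_ne_top : ∃ x, f x ≠ ⊤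
  closed : LowerSemicontinuous f
  convex : ∀ (x y : Space d) (a b : ℝ), 0 < a → 0 < b → a + b = 1 →
    f (a • x + b • y) ≤ (a : EReal) * f x + (b : EReal) * f y

/-- The function `u ↦ f u + ‖x - u‖² / (2 λ)` minimized by the proximal map at `x`. -/
def proxObjective {d : ℕ} (f : Space d → EReal) (lam : ℝ) (x u : Space d) : EReal :=
  f u + ((1 / (2 * lam) * ‖x - u‖ ^ 2 : ℝ) : EReal)

/-- `z = Prox_{λ f}(x)`, that is, `z` minimizes `f + ‖x - ·‖² / (2 λ)` over `ℝ^d`. -/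
def IsProx {d : ℕ} (f : Space d → EReal) (lam : ℝ) (x z : Space d) : Prop :=
  ∀ u, proxObjective f lam x z ≤ proxObjective f lam x u

/-- The Moreau envelope of `f`, with values in the extended reals. -/
def moreauEnvelope {d : ℕ} (f : Space d → EReal) (lam : ℝ) (x : Space d) : EReal :=
  ⨅ u, proxObjective f lam x u

/-- The Moreau envelope `f^λ` as a real function (it is finite for the functions at hand). -/
def envelope {d : ℕ} (f : Space d → EReal) (lam : ℝ) (x : Space d) : ℝ :=
  (moreauEnvelope f lam x).toReal

/-- `(x^k, z^k)`, `0 ≤ k ≤ N`, is generated by the relaxed proximal point algorithm with the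
relaxation schedule `α = (α_0, …, α_{N-1})`, where `N` is the length of `α`, from `x^0 = x0`.
Values of `x`, `z` at indices above `N` are irrelevant. -/
structure IsRun {d : ℕ} (f : Space d → EReal) (lam : ℝ) (α : List ℝ) (x0 : Space d)
    (x z : ℕ → Space d) : Prop where
  init : x 0 = x0
  prox : ∀ k ≤ α.length, IsProx f lam (x k) (z k)
  relax : ∀ (k : ℕ) (hk : k < α.length), x (k + 1) = x k + α[k] • (z k - x k)

/-- The silver ratio `ρ = 1 + √2`. -/
def rho : ℝ := 1 + Real.sqrt 2

/-- The silver schedule `π^(m)`, of length `2^m - 1`; the schedule `π^(0)` is empty. -/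
def silver : ℕ → List ℝ
  | 0 => []
  | 1 => [Real.sqrt 2]
  | m + 2 => silver (m + 1) ++ [1 + rho ^ m] ++ silver (m + 1)

/-- `γ_m`, the positive root of `γ² = γ + ρ^m`. -/
def gam (m : ℕ) : ℝ := (1 + Real.sqrt (1 + 4 * rho ^ m)) / 2

/-- The left silver schedule `[γ_m, π^(m)]`, which is `[γ_0]` for `m = 0`. -/
def leftSilver (m : ℕ) : List ℝ := gam m :: silver m

/-- `T_m = 1 + γ_m + ∑ π^(m)_i`, one plus the sum of the left silver schedule. -/
def T (m : ℕ) : ℝ := 1 + gam m + (silver m).sum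

theorem silver_length (m : ℕ) : (silver m).length + 1 = 2 ^ m := by
  induction m with
  | zero => simp [silver]
  | succ m ih =>
    cases m with
    | zero => simp [silver]
    | succ k =>
      have h : (2 : ℕ) ^ (k + 1 + 1) = 2 ^ (k + 1) + 2 ^ (k + 1) := by ring
      simp only [silver, List.length_append, List.length_cons, List.length_nil]
      omega

/-- The left silver schedule consists of `N = 2^m` steps. -/
theorem leftSilver_length (m : ℕ) : (leftSilver m).length = 2 ^ m := by
  simpa [leftSilver] using silver_length m

end RPPA

end

/-! With `F = λ f` and `g = x - z`, the proximal condition says that `g` is a subgradient of `F` at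
`z`, and `∇f^λ(x) = g / λ`. So the bound reduces to `T_m ‖g_N‖² ≤ F x⁰ - F z^N`, proved from
subgradient inequalities alone. The induction invariant for a silver run is `SilverCertificate`, of
rate `ρ^m`: three inequalities sharing one quantity `Φ`. `SilverCertificate.glue` joins two such
runs across the middle step and multiplies the rate by `ρ`. The other key lemma,
`SilverCertificate.norm_sq_le_gap`, eliminates `Φ` when the run starts by overshooting a proximal
point; it serves both in the gluing and for the initial step `γ_m`. The equation `γ² = γ + ρ^m`
balances its two coefficients and makes `T_m = γ_m²`. Tightness comes from the norm: along a ray,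
the last iterate lands at distance `λ` from the minimizer. -/

namespace RPPA

/-! ### Certificates from subgradient inequalities -/

section Certificate

variable {E : Type*} [NormedAddCommGroup E] [InnerProductSpace ℝ E]

/-- `x - z` is a subgradient at `z` of the function `F` with domain `S`. -/
structure SubgradAt (S : Set E) (F : E → ℝ) (x z : E) : Prop where
  mem : z ∈ S
  le : ∀ u ∈ S, F z + inner ℝ (x - z) (u - z) ≤ F u

/-- What a run from `x0` with a silver schedule of rate `r` guarantees about its last iterate `x`
and its proximal point `z`. The real number `Φ` stands for a weighted sum of function value gaps
and squared subgradient norms along the run. -/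
structure SilverCertificate (S : Set E) (F : E → ℝ) (r Φ : ℝ) (x0 x z : E) : Prop where
  subgrad : SubgradAt S F x z
  norm_sq_le : (r ^ 2 - 1) * ‖x - z‖ ^ 2 ≤ Φ
  norm_sq_le_add_dist : (2 * r ^ 2 - 1) * ‖x - z‖ ^ 2 ≤ Φ + ‖x0 - z‖ ^ 2
  le_gap : ∀ u ∈ S, Φ + ‖x - z‖ ^ 2 + ‖z - u‖ ^ 2 - ‖x0 - u‖ ^ 2 ≤ 2 * r * (F u - F z)

theorem norm_sub_smul_sub_sq (z g u : E) (t : ℝ) :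
    ‖z - t • g - u‖ ^ 2 = ‖z - u‖ ^ 2 + 2 * t * inner ℝ g (u - z) + t ^ 2 * ‖g‖ ^ 2 := by
  have h : z - t • g - u = -((u - z) + t • g) := by abel
  rw [h, norm_neg, norm_add_sq_real, inner_smul_right, norm_smul, mul_pow, Real.norm_eq_abs,
    sq_abs, real_inner_comm, norm_sub_rev u z]
  ring

theorem SubgradAt.certificate_one {S : Set E} {F : E → ℝ} {x z : E} (h : SubgradAt S F x z) :
    SilverCertificate S F 1 0 x x z where
  subgrad := h
  norm_sq_le := by simp
  norm_sq_le_add_dist := by linarith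
  le_gap u hu := by
    have h1 := h.le u hu
    have h2 := norm_sub_smul_sub_sq z (x - z) u (-1)
    have h3 : z - (-1 : ℝ) • (x - z) - u = x - u := by rw [neg_smul, one_smul]; abel
    rw [h3] at h2
    linarith

/-- The gradient norm guarantee of a run started at `zA - t • (xA - zA)`. -/
theorem SilverCertificate.norm_sq_le_gap {S : Set E} {F : E → ℝ} {r Φ t : ℝ} {xA zA x0 x z : E}
    (h : SilverCertificate S F r Φ x0 x z) (hA : SubgradAt S F xA zA) (ht : 0 ≤ t)
    (hx0 : x0 = zA - t • (xA - zA)) :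
    r ^ 2 * ‖x - z‖ ^ 2 ≤ (r - t) * (F zA - F z) + t ^ 2 * ‖xA - zA‖ ^ 2 := by
  -- Adding these two bounds cancels `Φ` and `‖z - zA‖²`; the remaining inner product is controlled
  -- by the subgradient at `zA`.
  have h1 := h.norm_sq_le_add_dist
  have h2 := h.le_gap zA hA.mem
  have h3 := mul_le_mul_of_nonneg_left (hA.le z h.subgrad.mem) ht
  rw [hx0, norm_sub_smul_sub_sq] at h1 h2
  rw [sub_self, inner_zero_right, norm_zero] at h2
  rw [norm_sub_rev zA z] at h1
  linarith

/-- Two silver runs of rate `r`, joined by a step of length `1 + r / ρ`, form one of rate `ρ r`. -/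
theorem SilverCertificate.glue {S : Set E} {F : E → ℝ} {r ΦA ΦB : ℝ} {x0 xA zA xe xB zB : E}
    (hr : 0 ≤ r) (hA : SilverCertificate S F r ΦA x0 xA zA)
    (hB : SilverCertificate S F r ΦB xe xB zB)
    (hxe : xe = xA + (1 + r * (√2 - 1)) • (zA - xA)) :
    SilverCertificate S F (rho * r)
      (ΦA + ΦB + 2 * √2 * r * (F zA - F zB) + (1 - (r * (√2 - 1)) ^ 2) * ‖xA - zA‖ ^ 2)
      x0 xB zB := by
  have hq : √2 ^ 2 = (2 : ℝ) := Real.sq_sqrt (by norm_num)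
  have hq1 : (1 : ℝ) ≤ √2 := Real.one_le_sqrt.2 (by norm_num)
  have ht : 0 ≤ r * (√2 - 1) := mul_nonneg hr (by linarith)
  -- The joining step overshoots `zA` by `t = r (√2 - 1) = r / ρ` times the subgradient.
  have hxe' : xe = zA - (r * (√2 - 1)) • (xA - zA) := by
    rw [hxe]; module
  have hD := hB.norm_sq_le_gap hA.subgrad ht hxe'
  have hPA := hA.norm_sq_le
  have hPB := hB.norm_sq_le
  have hRB := hB.norm_sq_le_add_dist
  have hSA := hA.le_gap zB hB.subgrad.mem
  have hQ := mul_le_mul_of_nonneg_left (hA.subgrad.le zB hB.subgrad.mem) ht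
  rw [hxe', norm_sub_smul_sub_sq] at hRB
  unfold rho
  generalize √2 = q at *
  -- This is `hD` times `ρ = 1 + q`, simplified by `ρ (r - t) = q r` and `ρ t² = r² (q - 1)`.
  have hD' : r ^ 2 * (1 + q) * ‖xB - zB‖ ^ 2
      ≤ q * r * (F zA - F zB) + r ^ 2 * (q - 1) * ‖xA - zA‖ ^ 2 := by
    have := mul_le_mul_of_nonneg_left hD (show 0 ≤ 1 + q by linarith)
    linear_combination this + (-r * (F zA - F zB) + r ^ 2 * (q - 1) * ‖xA - zA‖ ^ 2) * hq
  refine ⟨hB.subgrad, ?_, ?_, fun u hu => ?_⟩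
  · linear_combination hPA + hPB + 2 * hD' + (r ^ 2 * ‖xB - zB‖ ^ 2 + r ^ 2 * ‖xA - zA‖ ^ 2) * hq
  -- `‖zA - zB‖²` cancels between `hSA` and `hRB`, and `hQ` absorbs the inner product from expanding
  -- `‖xe - zB‖²`.
  · linear_combination hSA + 2 * hPA + hRB + 2 * hQ + 4 * hD' +
      (2 * r ^ 2 * ‖xB - zB‖ ^ 2 + 2 * r ^ 2 * ‖xA - zA‖ ^ 2) * hq
  -- The distances telescope. The weights of `F u` add up to `2r + 2r + 2t = 2ρr`, which dictates
  -- the joining step, and what is left over is exactly the new part of `Φ`.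
  · have h1 := hA.le_gap u hu
    have h2 := hB.le_gap u hu
    have h3 := mul_le_mul_of_nonneg_left (hA.subgrad.le u hu) ht
    rw [hxe', norm_sub_smul_sub_sq] at h2
    linear_combination h1 + h2 + 2 * h3

end Certificate

/-! ### Certificates for silver runs -/

/-- Since `1 / ρ = √2 - 1`, the middle step `1 + ρ^(m-1)` can be written without a negative
exponent, so that one recursion also covers `m = 0`. -/
theorem silver_succ (m : ℕ) :
    silver (m + 1) = silver m ++ (1 + rho ^ m * (√2 - 1)) :: silver m := by
  have hq : √2 * √2 = (2 : ℝ) := Real.mul_self_sqrt (by norm_num)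
  cases m with
  | zero => simp [silver]
  | succ k =>
    have : rho ^ (k + 1) * (√2 - 1) = rho ^ k := by
      have : rho * (√2 - 1) = 1 := by unfold rho; linear_combination hq
      rw [pow_succ, mul_assoc, this, mul_one]
    rw [this]
    simp [silver]

/-- The offset `s` lets the induction hypothesis apply to both halves of the run. The default of
`getD` is never reached, as all indices are below `n`, the length of the schedule. -/
theorem exists_silverCertificate {E : Type*} [NormedAddCommGroup E] [InnerProductSpace ℝ E]
    {S : Set E} {F : E → ℝ} {x z : ℕ → E} (m s n : ℕ) (hn : n + 1 = 2 ^ m)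
    (hsub : ∀ k, s ≤ k → k ≤ s + n → SubgradAt S F (x k) (z k))
    (hx : ∀ k, k < n →
      x (s + k + 1) = x (s + k) + (silver m).getD k 0 • (z (s + k) - x (s + k))) :
    ∃ Φ, SilverCertificate S F (rho ^ m) Φ (x s) (x (s + n)) (z (s + n)) := by
  induction m generalizing s n with
  | zero =>
    obtain rfl : n = 0 := by simpa using hn
    exact ⟨0, by simpa using (hsub s le_rfl le_rfl).certificate_one⟩
  | succ m ih =>
    obtain ⟨l, hl⟩ : ∃ l, l + 1 = 2 ^ m := ⟨_, silver_length m⟩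
    have hlen : (silver m).length = l := by have := silver_length m; omega
    obtain rfl : n = l + 1 + l := by rw [pow_succ] at hn; omega
    rw [silver_succ] at hx
    obtain ⟨ΦA, hA⟩ := ih s l hl (fun k h1 h2 => hsub k h1 (by omega)) fun k hk => by
      rw [hx k (by omega), List.getD_append _ _ _ _ (by omega)]
    obtain ⟨ΦB, hB⟩ := ih (s + l + 1) l hl (fun k h1 h2 => hsub k (by omega) (by omega))
      fun k hk => by
        have := hx (l + 1 + k) (by omega)
        rw [List.getD_append_right _ _ _ _ (by omega),
          show l + 1 + k - (silver m).length = k + 1 by omega, List.getD_cons_succ] at this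
        rw [show s + l + 1 + k = s + (l + 1 + k) by ring, this]
    have hstep := hx l (by omega)
    rw [List.getD_append_right _ _ _ _ (by omega), hlen, Nat.sub_self,
      List.getD_cons_zero] at hstep
    have hrho : (0 : ℝ) ≤ rho ^ m := by unfold rho; positivity
    have := SilverCertificate.glue hrho hA hB hstep
    rw [← pow_succ'] at this
    rw [show s + (l + 1 + l) = s + l + 1 + l by ring]
    exact ⟨_, this⟩

/-! ### Proximal map and Moreau envelope -/

section Prox

variable {d : ℕ} {f : Space d → EReal} {lam : ℝ} {x z u : Space d}

theorem proxObjective_of_ne_top (hbot : f u ≠ ⊥) (htop : f u ≠ ⊤) :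
    proxObjective f lam x u = (((f u).toReal + 1 / (2 * lam) * ‖x - u‖ ^ 2 : ℝ) : EReal) := by
  rw [proxObjective, EReal.coe_add, EReal.coe_toReal htop hbot]

theorem IsProx.ne_top (hf : ProperClosedConvex f) (h : IsProx f lam x z) : f z ≠ ⊤ := by
  obtain ⟨u, hu⟩ := hf.exists_ne_top
  intro hz
  have h1 := h u
  rw [proxObjective_of_ne_top (hf.ne_bot u) hu, proxObjective, hz, EReal.top_add_coe, top_le_iff]
    at h1
  exact EReal.coe_ne_top _ h1

theorem IsProx.le (hf : ProperClosedConvex f) (h : IsProx f lam x z) (hu : f u ≠ ⊤) :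
    (f z).toReal + 1 / (2 * lam) * ‖x - z‖ ^ 2 ≤ (f u).toReal + 1 / (2 * lam) * ‖x - u‖ ^ 2 := by
  have h1 := h u
  rwa [proxObjective_of_ne_top (hf.ne_bot u) hu,
    proxObjective_of_ne_top (hf.ne_bot z) (h.ne_top hf), EReal.coe_le_coe_iff] at h1

theorem ProperClosedConvex.toReal_le (hf : ProperClosedConvex f) {x y : Space d} (hx : f x ≠ ⊤)
    (hy : f y ≠ ⊤) {a b : ℝ} (ha : 0 < a) (hb : 0 < b) (hab : a + b = 1) :
    f (a • x + b • y) ≠ ⊤ ∧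
      (f (a • x + b • y)).toReal ≤ a * (f x).toReal + b * (f y).toReal := by
  have h := hf.convex x y a b ha hb hab
  rw [← EReal.coe_toReal hx (hf.ne_bot x), ← EReal.coe_toReal hy (hf.ne_bot y),
    ← EReal.coe_mul, ← EReal.coe_mul, ← EReal.coe_add] at h
  have hne : f (a • x + b • y) ≠ ⊤ := (h.trans_lt (EReal.coe_lt_top _)).ne
  refine ⟨hne, ?_⟩
  rwa [← EReal.coe_toReal hne (hf.ne_bot _), EReal.coe_le_coe_iff] at h

/-- The optimality condition of the proximal problem. -/
theorem IsProx.subgradAt (hf : ProperClosedConvex f) (hlam : 0 < lam) (h : IsProx f lam x z) :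
    SubgradAt {u | f u ≠ ⊤} (fun u => lam * (f u).toReal) x z where
  mem := h.ne_top hf
  le u hu := by
    -- Compare `z` with the point `(1 - t) z + t u` of the segment, use convexity and divide by `t`.
    have key : ∀ t : ℝ, 0 < t → t < 1 →
        lam * (f z).toReal + inner ℝ (x - z) (u - z) - lam * (f u).toReal
          ≤ t * ‖u - z‖ ^ 2 := by
      intro t ht0 ht1
      obtain ⟨hw, hle⟩ := hf.toReal_le (h.ne_top hf) hu (sub_pos.2 ht1) ht0 (by ring)
      have h1 := h.le hf hw
      have h2 : x - ((1 - t) • z + t • u) = (x - z) - t • (u - z) := by module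
      rw [h2, norm_sub_sq_real (x - z), inner_smul_right, norm_smul, mul_pow, Real.norm_eq_abs, sq_abs]
        at h1
      have h3 : 0 ≤ t * (lam * (f u).toReal - lam * (f z).toReal
          - inner ℝ (x - z) (u - z) + t * ‖u - z‖ ^ 2 / 2) := by
        have h4 := mul_le_mul_of_nonneg_left (h1.trans (add_le_add_left hle _)) hlam.le
        field_simp at h4
        linarith
      have h5 := nonneg_of_mul_nonneg_right h3 ht0
      have h6 : 0 ≤ t * ‖u - z‖ ^ 2 := by positivity
      linarith
    by_contra! hlt
    set D := lam * (f z).toReal + inner ℝ (x - z) (u - z) - lam * (f u).toReal with hD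
    have hD0 : 0 < D := by linarith
    set B := ‖u - z‖ ^ 2 with hB
    have hB0 : 0 ≤ B := by positivity
    -- A value of `t` in `(0, 1)` with `t B < D`, in place of the limit `t → 0`.
    have h1 := key (D / (2 * (D + B))) (by positivity)
      (by rw [div_lt_one (by positivity)]; linarith)
    rw [div_mul_eq_mul_div, le_div_iff₀ (by positivity)] at h1
    nlinarith [mul_nonneg hD0.le hB0]

theorem SubgradAt.isProx (hbot : ∀ u, f u ≠ ⊥) (hlam : 0 < lam)
    (h : SubgradAt {u | f u ≠ ⊤} (fun u => lam * (f u).toReal) x z) : IsProx f lam x z := by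
  intro u
  by_cases hu : f u = ⊤
  · rw [proxObjective, proxObjective, hu, EReal.top_add_coe]
    exact le_top
  rw [proxObjective_of_ne_top (hbot u) hu, proxObjective_of_ne_top (hbot z) h.mem,
    EReal.coe_le_coe_iff]
  have h1 := h.le u hu
  have h2 : ‖x - u‖ ^ 2 = ‖x - z‖ ^ 2 - 2 * inner ℝ (x - z) (u - z) + ‖u - z‖ ^ 2 := by
    rw [← norm_sub_sq_real, sub_sub_sub_cancel_right]
  have h3 := sq_nonneg ‖u - z‖
  rw [h2]
  field_simp
  linarith

theorem SubgradAt.inner_nonneg {E : Type*} [NormedAddCommGroup E] [InnerProductSpace ℝ E]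
    {S : Set E} {F : E → ℝ} {x z x' z' : E} (h : SubgradAt S F x z) (h' : SubgradAt S F x' z') :
    0 ≤ inner ℝ ((x - z) - (x' - z')) (z - z') := by
  have h1 := h.le z' h'.mem
  have h2 := h'.le z h.mem
  rw [← neg_sub z z', inner_neg_right] at h1
  rw [inner_sub_left]
  linarith

theorem IsProx.unique (hf : ProperClosedConvex f) (hlam : 0 < lam) {z' : Space d}
    (h : IsProx f lam x z) (h' : IsProx f lam x z') : z = z' := by
  have h1 := (h.subgradAt hf hlam).inner_nonneg (h'.subgradAt hf hlam)
  rw [show (x - z) - (x - z') = -(z - z') by abel, inner_neg_left, real_inner_self_eq_norm_sq]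
    at h1
  have h2 : ‖z - z'‖ ^ 2 = 0 := le_antisymm (by linarith) (sq_nonneg _)
  exact sub_eq_zero.1 (norm_eq_zero.1 (pow_eq_zero_iff two_ne_zero |>.1 h2))

theorem lowerSemicontinuous_proxObjective (hf : LowerSemicontinuous f) (lam : ℝ) (x : Space d) :
    LowerSemicontinuous (proxObjective f lam x) := by
  have hc : Continuous fun u : Space d => ((1 / (2 * lam) * ‖x - u‖ ^ 2 : ℝ) : EReal) :=
    continuous_coe_real_ereal.comp (by fun_prop)
  exact hf.add' hc.lowerSemicontinuous fun u =>
    EReal.continuousAt_add (Or.inr (EReal.coe_ne_bot _)) (Or.inr (EReal.coe_ne_top _))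

/-- Outside the ball about `x` through the minimizer `xs`, no point does better than `xs`, so
compactness of the ball suffices. -/
theorem exists_isProx (hf : LowerSemicontinuous f) (hlam : 0 < lam) {xs : Space d}
    (hxs : ∀ y, f xs ≤ f y) (x : Space d) : ∃ z, IsProx f lam x z := by
  have hmem : xs ∈ Metric.closedBall x ‖x - xs‖ := by
    rw [mem_closedBall_iff_norm, norm_sub_rev]
  obtain ⟨z, -, hz⟩ := ((lowerSemicontinuous_proxObjective hf lam x).lowerSemicontinuousOn
    _).exists_isMinOn ⟨xs, hmem⟩ (isCompact_closedBall x ‖x - xs‖)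
  refine ⟨z, fun u => ?_⟩
  by_cases hu : u ∈ Metric.closedBall x ‖x - xs‖
  · exact hz hu
  · refine (hz hmem).trans (add_le_add (hxs u) (EReal.coe_le_coe_iff.2 ?_))
    rw [mem_closedBall_iff_norm, not_le, norm_sub_rev u x] at hu
    gcongr

theorem IsProx.moreauEnvelope_eq (h : IsProx f lam x z) :
    moreauEnvelope f lam x = proxObjective f lam x z :=
  le_antisymm (iInf_le _ z) (le_iInf h)

theorem IsProx.envelope_eq (hf : ProperClosedConvex f) (h : IsProx f lam x z) :
    envelope f lam x = (f z).toReal + 1 / (2 * lam) * ‖x - z‖ ^ 2 := by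
  rw [envelope, h.moreauEnvelope_eq, proxObjective_of_ne_top (hf.ne_bot z) (h.ne_top hf),
    EReal.toReal_coe]

/-- The gradient of the Moreau envelope. -/
theorem IsProx.hasGradientAt_envelope (hf : ProperClosedConvex f) (hlam : 0 < lam)
    (hex : ∀ y, ∃ w, IsProx f lam y w) (h : IsProx f lam x z) :
    HasGradientAt (envelope f lam) (lam⁻¹ • (x - z)) x := by
  rw [hasGradientAt_iff_isLittleO]
  -- The remainder lies between `0` and `‖y - x‖² / (2λ)`: above by using `z` as a competitor at
  -- `y`, below by the subgradient at `z` tested at `w` and the square `e3`.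
  have hO : (fun y => envelope f lam y - envelope f lam x - inner ℝ (lam⁻¹ • (x - z)) (y - x))
      =O[𝓝 x] fun y => ‖y - x‖ ^ 2 := by
    refine Asymptotics.IsBigO.of_bound (1 / (2 * lam)) (Eventually.of_forall fun y => ?_)
    obtain ⟨w, hw⟩ := hex y
    have h1 := hw.le hf (h.ne_top hf)
    have h2 := (h.subgradAt hf hlam).le w (hw.ne_top hf)
    have e1 : ‖y - z‖ ^ 2 = ‖y - x‖ ^ 2 + 2 * inner ℝ (x - z) (y - x) + ‖x - z‖ ^ 2 := by
      rw [show y - z = (y - x) + (x - z) by abel, norm_add_sq_real, real_inner_comm]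
    have e2 : ‖(y - w) - (x - z)‖ ^ 2 = ‖y - w‖ ^ 2 - 2 * (inner ℝ (x - z) (y - x)
        + ‖x - z‖ ^ 2 - inner ℝ (x - z) (w - z)) + ‖x - z‖ ^ 2 := by
      rw [norm_sub_sq_real, real_inner_comm, ← real_inner_self_eq_norm_sq (x - z), ← inner_add_right,
        ← inner_sub_right, show y - x + (x - z) - (w - z) = y - w by abel]
    have e3 := sq_nonneg ‖(y - w) - (x - z)‖
    rw [hw.envelope_eq hf, h.envelope_eq hf, real_inner_smul_left, Real.norm_eq_abs,
      Real.norm_eq_abs, abs_of_nonneg (sq_nonneg ‖y - x‖), abs_of_nonneg]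
    · rw [e1] at h1
      field_simp at h1 ⊢
      linarith
    · field_simp
      linarith
  refine hO.trans_isLittleO ?_
  have h0 : (fun v : Space d => ‖v‖ ^ 2) =o[𝓝 0] fun v => v := by
    simpa using Asymptotics.isLittleO_norm_pow_id (E' := Space d) one_lt_two
  exact h0.comp_tendsto (tendsto_sub_nhds_zero_iff.2 tendsto_id)

end Prox

/-! ### The constants `ρ`, `γ_m` and `T_m` -/

theorem one_lt_rho : 1 < rho := by unfold rho; simp

theorem gam_sq (m : ℕ) : gam m ^ 2 = gam m + rho ^ m := by
  have h0 : (0 : ℝ) ≤ rho ^ m := pow_nonneg (zero_lt_one.trans one_lt_rho).le m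
  have h := Real.sq_sqrt (show 0 ≤ 1 + 4 * rho ^ m by positivity)
  unfold gam
  linear_combination h / 4

theorem one_lt_gam (m : ℕ) : 1 < gam m := by
  have h0 : (0 : ℝ) < rho ^ m := pow_pos (zero_lt_one.trans one_lt_rho) m
  have h : 1 < √(1 + 4 * rho ^ m) := by
    rw [Real.lt_sqrt zero_le_one]; linarith
  unfold gam
  linarith

theorem silver_sum (m : ℕ) : (silver m).sum = rho ^ m - 1 := by
  have hq : √2 * √2 = (2 : ℝ) := Real.mul_self_sqrt (by norm_num)
  induction m with
  | zero => simp [silver]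
  | succ m ih =>
    rw [silver_succ, List.sum_append, List.sum_cons, ih, pow_succ]
    nth_rewrite 5 [rho]
    ring

theorem silver_nonneg (m : ℕ) : ∀ a ∈ silver m, 0 ≤ a := by
  induction m with
  | zero => simp [silver]
  | succ m ih =>
    have h0 : (0 : ℝ) ≤ rho ^ m := pow_nonneg (zero_lt_one.trans one_lt_rho).le m
    have h1 : (1 : ℝ) ≤ √2 := Real.one_le_sqrt.2 (by norm_num)
    have h2 := mul_nonneg h0 (sub_nonneg.2 h1)
    intro a ha
    rw [silver_succ, List.mem_append, List.mem_cons] at ha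
    rcases ha with ha | rfl | ha
    · exact ih a ha
    · linarith
    · exact ih a ha

theorem T_eq (m : ℕ) : T m = gam m + rho ^ m := by
  rw [T, silver_sum]; ring

theorem T_pos (m : ℕ) : 0 < T m := by
  rw [T_eq, ← gam_sq]
  exact pow_pos (zero_lt_one.trans (one_lt_gam m)) 2

/-! ### The upper bound -/

/-- The guarantee of the left silver schedule in terms of subgradients. -/
theorem T_mul_norm_sq_le {E : Type*} [NormedAddCommGroup E] [InnerProductSpace ℝ E]
    {S : Set E} {F : E → ℝ} {x z : ℕ → E} (m : ℕ) (h0 : x 0 ∈ S)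
    (hsub : ∀ k ≤ 2 ^ m, SubgradAt S F (x k) (z k))
    (hx : ∀ (k : ℕ) (hk : k < (leftSilver m).length),
      x (k + 1) = x k + (leftSilver m)[k] • (z k - x k)) :
    T m * ‖x (2 ^ m) - z (2 ^ m)‖ ^ 2 ≤ F (x 0) - F (z (2 ^ m)) := by
  obtain ⟨n, hn⟩ : ∃ n, n + 1 = 2 ^ m := ⟨_, silver_length m⟩
  obtain ⟨Φ, h⟩ := exists_silverCertificate (S := S) (F := F) (x := x) (z := z) m 1 n hn
    (fun k _ hk => hsub k (by omega)) fun k hk => by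
      have hk' : k < (silver m).length := by have := silver_length m; omega
      rw [List.getD_eq_getElem _ _ hk', show 1 + k = k + 1 by ring]
      exact hx (k + 1) (by simpa [leftSilver] using hk')
  rw [show 1 + n = 2 ^ m by omega] at h
  have hg := one_lt_gam m
  have hx1 : x 1 = x 0 + gam m • (z 0 - x 0) := hx 0 (by simp [leftSilver])
  -- The step `γ` overshoots `z 0` by `t = γ - 1`. As `ρ^m = γ (γ - 1)`, the coefficients `r - t`
  -- and `t²` both equal `(γ - 1)²`, which is then divided out.
  have h1 := h.norm_sq_le_gap (hsub 0 (by positivity)) (t := gam m - 1) (by linarith)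
    (by rw [hx1]; module)
  -- Testing at `x 0` itself gives `F (z 0) + ‖x 0 - z 0‖² ≤ F (x 0)`; this is where `x 0` must lie
  -- in the domain.
  have h2 := (hsub 0 (by positivity)).le (x 0) h0
  rw [real_inner_self_eq_norm_sq] at h2
  have hr : rho ^ m = gam m * (gam m - 1) := by linear_combination - gam_sq m
  rw [hr] at h1
  have h3 : (gam m - 1) ^ 2 * (gam m ^ 2 * ‖x (2 ^ m) - z (2 ^ m)‖ ^ 2)
      ≤ (gam m - 1) ^ 2 * (F (z 0) - F (z (2 ^ m)) + ‖x 0 - z 0‖ ^ 2) := by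
    linear_combination h1
  have h4 := le_of_mul_le_mul_left h3 (pow_pos (sub_pos.2 hg) 2)
  rw [T_eq, ← gam_sq]
  linarith

theorem IsRun.envelope_gradient_le {d : ℕ} {f : Space d → EReal} (hf : ProperClosedConvex f)
    {lam : ℝ} (hlam : 0 < lam) {xs : Space d} (hxs : ∀ y, f xs ≤ f y) {m : ℕ} {x0 : Space d}
    (hx0 : f x0 < ⊤) {x z : ℕ → Space d} (h : IsRun f lam (leftSilver m) x0 x z) :
    DifferentiableAt ℝ (envelope f lam) (x (2 ^ m)) ∧
      lam / 2 * ‖gradient (envelope f lam) (x (2 ^ m))‖ ^ 2 ≤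
        1 / (2 * T m) * ((f x0).toReal - (f xs).toReal) := by
  have hprox : ∀ k ≤ 2 ^ m, IsProx f lam (x k) (z k) := fun k hk =>
    h.prox k (by rwa [leftSilver_length])
  have hgrad := (hprox _ le_rfl).hasGradientAt_envelope hf hlam (exists_isProx hf.closed hlam hxs)
  refine ⟨hgrad.differentiableAt, ?_⟩
  have h1 := T_mul_norm_sq_le m (by rw [h.init]; exact hx0.ne)
    (fun k hk => (hprox k hk).subgradAt hf hlam) h.relax
  have hz := (hprox _ le_rfl).ne_top hf
  have h2 : (f xs).toReal ≤ (f (z (2 ^ m))).toReal :=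
    EReal.toReal_le_toReal (hxs _) (hf.ne_bot _) hz
  have h3 := mul_le_mul_of_nonneg_left h2 hlam.le
  have hT := T_pos m
  rw [h.init] at h1
  rw [hgrad.gradient, norm_smul, mul_pow, norm_inv, Real.norm_of_nonneg hlam.le]
  have h4 : lam / 2 * (lam⁻¹ ^ 2 * ‖x (2 ^ m) - z (2 ^ m)‖ ^ 2)
      = 1 / (2 * T m * lam) * (T m * ‖x (2 ^ m) - z (2 ^ m)‖ ^ 2) := by
    field_simp
  have h5 : 1 / (2 * T m) * ((f x0).toReal - (f xs).toReal)
      = 1 / (2 * T m * lam) * (lam * (f x0).toReal - lam * (f xs).toReal) := by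
    field_simp
  rw [h4, h5]
  exact mul_le_mul_of_nonneg_left (by linarith) (by positivity)

/-! ### Asymptotics -/

theorem two_pow_rpow_logb_rho (m : ℕ) : ((2 : ℝ) ^ m) ^ Real.logb 2 rho = rho ^ m := by
  rw [← Real.rpow_natCast, ← Real.rpow_mul zero_le_two, mul_comm, Real.rpow_mul zero_le_two,
    Real.rpow_logb zero_lt_two (by norm_num) (zero_lt_one.trans one_lt_rho), Real.rpow_natCast]

theorem tendsto_T_div : Tendsto (fun m : ℕ => T m / rho ^ m) atTop (𝓝 1) := by
  have hpos : ∀ m : ℕ, (0 : ℝ) < rho ^ m := pow_pos (zero_lt_one.trans one_lt_rho)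
  have hp : Tendsto (fun m : ℕ => rho ^ m) atTop atTop := tendsto_pow_atTop_atTop_of_one_lt one_lt_rho
  have hg : Tendsto gam atTop atTop := by
    have : Tendsto (fun m : ℕ => √(1 + 4 * rho ^ m)) atTop atTop :=
      Real.tendsto_sqrt_atTop.comp
        (tendsto_atTop_add_const_left _ 1 (hp.const_mul_atTop (by norm_num)))
    exact (tendsto_atTop_add_const_left _ 1 this).atTop_div_const (by norm_num)
  -- `T m / ρ^m = γ² / (γ (γ - 1)) = 1 + 1 / (γ - 1)`.
  have h1 : Tendsto (fun m => 1 + (gam m - 1)⁻¹) atTop (𝓝 (1 + 0)) :=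
    tendsto_const_nhds.add
      (tendsto_inv_atTop_zero.comp (tendsto_atTop_add_const_right _ (-1) hg))
  rw [add_zero] at h1
  refine h1.congr fun m => ?_
  have h2 := one_lt_gam m
  have h3 : rho ^ m = gam m * (gam m - 1) := by linear_combination - gam_sq m
  have h4 : gam m - 1 ≠ 0 := by linarith
  rw [T_eq, h3]
  field_simp
  ring

/-! ### Tightness for the norm -/

theorem isProx_norm {d : ℕ} {lam c : ℝ} (hlam : 0 < lam) (hc : lam ≤ c) {e : Space d}
    (he : ‖e‖ = 1) : IsProx (fun u => ((‖u‖ : ℝ) : EReal)) lam (c • e) ((c - lam) • e) := by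
  refine SubgradAt.isProx (fun u => EReal.coe_ne_bot _) hlam ⟨EReal.coe_ne_top _, fun u _ => ?_⟩
  have h1 : inner ℝ e u ≤ ‖u‖ := by simpa [he] using real_inner_le_norm e u
  have h2 : c • e - (c - lam) • e = lam • e := by module
  simp only [EReal.toReal_coe]
  rw [h2, real_inner_smul_left, inner_sub_right, real_inner_smul_right,
    real_inner_self_eq_norm_sq, norm_smul, he, Real.norm_of_nonneg (by linarith)]
  have h3 := mul_le_mul_of_nonneg_left h1 hlam.le
  linarith

theorem properClosedConvex_norm (d : ℕ) :
    ProperClosedConvex (fun u : Space d => ((‖u‖ : ℝ) : EReal)) where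
  ne_bot _ := EReal.coe_ne_bot _
  exists_ne_top := ⟨0, EReal.coe_ne_top _⟩
  closed := (continuous_coe_real_ereal.comp continuous_norm).lowerSemicontinuous
  convex x y a b ha hb _ := by
    rw [← EReal.coe_mul, ← EReal.coe_mul, ← EReal.coe_add, EReal.coe_le_coe_iff]
    refine (norm_add_le _ _).trans_eq ?_
    rw [norm_smul, norm_smul, Real.norm_of_nonneg ha.le, Real.norm_of_nonneg hb.le]

theorem sum_take_le_sum {l : List ℝ} (hl : ∀ a ∈ l, 0 ≤ a) (k : ℕ) : (l.take k).sum ≤ l.sum := by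
  rw [← List.sum_take_add_sum_drop l k]
  exact le_add_of_nonneg_right (List.sum_nonneg fun a ha => hl a (List.mem_of_mem_drop ha))

/-- The norm is a worst case function: started on a ray at distance `lam * (1 + α.sum)`, the
iterates walk along the ray. -/
theorem isRun_norm {d : ℕ} {lam : ℝ} (hlam : 0 < lam) {e : Space d} (he : ‖e‖ = 1) {α : List ℝ}
    (hα : ∀ a ∈ α, 0 ≤ a) :
    IsRun (fun u => ((‖u‖ : ℝ) : EReal)) lam α ((lam * (1 + α.sum)) • e)
      (fun k => (lam * (1 + α.sum - (α.take k).sum)) • e)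
      (fun k => (lam * (1 + α.sum - (α.take k).sum) - lam) • e) where
  init := by simp
  prox k _ := isProx_norm hlam
    (le_mul_of_one_le_right hlam.le (by linarith [sum_take_le_sum hα k])) he
  relax k hk := by
    rw [List.sum_take_succ _ _ hk]
    module

end RPPA

/-! ### The main theorem -/

theorem mainTheorem4 :
    -- the upper bound
    (∀ (d : ℕ) (f : RPPA.Space d → EReal), RPPA.ProperClosedConvex f →
      ∀ (lam : ℝ), 0 < lam →
      ∀ xs : RPPA.Space d, (∀ y, f xs ≤ f y) →
      ∀ (m : ℕ) (x0 : RPPA.Space d), f x0 < ⊤ →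
        -- the Moreau envelope is finite and the proximal map is well defined
        (∀ y, RPPA.moreauEnvelope f lam y ≠ ⊥ ∧ RPPA.moreauEnvelope f lam y ≠ ⊤) ∧
        (∀ y, ∃! z, RPPA.IsProx f lam y z) ∧
        ∀ x z : ℕ → RPPA.Space d, RPPA.IsRun f lam (RPPA.leftSilver m) x0 x z →
          DifferentiableAt ℝ (RPPA.envelope f lam) (x (2 ^ m)) ∧
          lam / 2 * ‖gradient (RPPA.envelope f lam) (x (2 ^ m))‖ ^ 2 ≤
            1 / (2 * RPPA.T m) * ((f x0).toReal - (f xs).toReal)) ∧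
    -- the asymptotics of the bound, with `N = 2 ^ m`
    Tendsto (fun m : ℕ => RPPA.T m / ((2 : ℝ) ^ m) ^ Real.logb 2 RPPA.rho) atTop (𝓝 1) ∧
    (∀ Δ : ℝ, 0 < Δ →
      Tendsto (fun m : ℕ => (1 / (2 * RPPA.T m) * Δ) /
        (1 / (2 * ((2 : ℝ) ^ m) ^ Real.logb 2 RPPA.rho) * Δ)) atTop (𝓝 1)) ∧
    -- tightness: the bound is attained by a nondegenerate instance
    (∀ (m d : ℕ), 0 < d → ∀ lam : ℝ, 0 < lam →
      ∃ (f : RPPA.Space d → EReal) (x0 xs : RPPA.Space d) (x z : ℕ → RPPA.Space d),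
        RPPA.ProperClosedConvex f ∧ (∀ y, f xs ≤ f y) ∧ f xs < f x0 ∧ f x0 < ⊤ ∧
        RPPA.IsRun f lam (RPPA.leftSilver m) x0 x z ∧
        lam / 2 * ‖gradient (RPPA.envelope f lam) (x (2 ^ m))‖ ^ 2 =
          1 / (2 * RPPA.T m) * ((f x0).toReal - (f xs).toReal)) := by
  simp only [RPPA.two_pow_rpow_logb_rho]
  refine ⟨fun d f hf lam hlam xs hxs m x0 hx0 => ⟨fun y => ?_, fun y => ?_, fun x z h =>
    h.envelope_gradient_le hf hlam hxs hx0⟩, RPPA.tendsto_T_div, fun Δ hΔ => ?_,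
    fun m d hd lam hlam => ?_⟩
  · obtain ⟨z, hz⟩ := RPPA.exists_isProx hf.closed hlam hxs y
    rw [hz.moreauEnvelope_eq, RPPA.proxObjective_of_ne_top (hf.ne_bot z) (hz.ne_top hf)]
    exact ⟨EReal.coe_ne_bot _, EReal.coe_ne_top _⟩
  · obtain ⟨z, hz⟩ := RPPA.exists_isProx hf.closed hlam hxs y
    exact ⟨z, hz, fun w hw => hw.unique hf hlam hz⟩
  · have h := RPPA.tendsto_T_div.inv₀ one_ne_zero
    rw [inv_one] at h
    refine h.congr fun m => ?_
    have h1 := RPPA.T_pos m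
    have h2 : (0 : ℝ) < RPPA.rho ^ m := pow_pos (zero_lt_one.trans RPPA.one_lt_rho) m
    field_simp
  · set α := RPPA.leftSilver m with hα
    have he : ‖EuclideanSpace.single (⟨0, hd⟩ : Fin d) (1 : ℝ)‖ = 1 := by simp
    set e : RPPA.Space d := EuclideanSpace.single (⟨0, hd⟩ : Fin d) (1 : ℝ)
    have hnonneg : ∀ a ∈ α, 0 ≤ a := by
      intro a ha
      rcases List.mem_cons.1 ha with rfl | ha
      · exact (zero_lt_one.trans (RPPA.one_lt_gam m)).le
      · exact RPPA.silver_nonneg m a ha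
    have hT : 1 + α.sum = RPPA.T m := by simp [hα, RPPA.leftSilver, RPPA.T, add_assoc]
    have hTpos := RPPA.T_pos m
    have hrun := RPPA.isRun_norm hlam he hnonneg
    have hf := RPPA.properClosedConvex_norm d
    have hmin : ∀ y : RPPA.Space d, ((‖(0 : RPPA.Space d)‖ : ℝ) : EReal) ≤ ((‖y‖ : ℝ) : EReal) :=
      fun y => EReal.coe_le_coe_iff.2 (by simp)
    have hx0 : ‖(lam * (1 + α.sum)) • e‖ = lam * RPPA.T m := by
      rw [hT, norm_smul, he, mul_one, Real.norm_of_nonneg (by positivity)]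
    refine ⟨_, _, 0, _, _, hf, hmin, ?_, EReal.coe_lt_top _, hrun, ?_⟩
    · rw [EReal.coe_lt_coe_iff, hx0, norm_zero]
      positivity
    -- Here `x - z = λ e`, so the gradient is the unit vector `e`; both sides equal `λ / 2` because
    -- the initial gap is `λ T_m`.
    · have hgrad := (hrun.prox (2 ^ m) (RPPA.leftSilver_length m).ge).hasGradientAt_envelope hf hlam
        (RPPA.exists_isProx hf.closed hlam hmin)
      rw [← sub_smul, sub_sub_cancel, smul_smul, inv_mul_cancel₀ hlam.ne', one_smul] at hgrad
      rw [hgrad.gradient, he, EReal.toReal_coe, EReal.toReal_coe, hx0, norm_zero]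
      field_simp
      ring
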